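/- All graphs are finite, simple and undirected, $\mathrm{d}_\Gamma(u,v)$ denotes distance in a graph $\Gamma$, and $\log$ is the natural logarithm. A set $R$ of vertices of $\Gamma$ is *resolving* if for any two distinct vertices $u,w$ there is $v\in R$ with $\mathrm{d}_\Gamma(u,v)\neq \mathrm{d}_\Gamma(w,v)$; the *metric dimension* $\mu(\Gamma)$ is the smallest size of a resolving set. A connected graph $\Gamma$ is *distance-regular* if, for all vertices $u,v$, the numbers of neighbours of $v$ at distances $i-1$, $i$, $i+1$ from $u$, where $i=\mathrm{d}_\Gamma(u,v)$, depend only on $i$. A distance-regular graph $\Gamma$ of diameter $d$ is *primitive* if for every $0<i\le d$ the graph on the same vertices in which $u,v$ are adjacent when $\mathrm{d}_\Gamma(u,v)=i$ is connected. It is *$t$-antipodal* if being at distance $0$ or $d$ is an equivalence relation on the vertices all of whose classes (the antipodal classes) have size $t$; the *folded graph* $\overline{\Gamma}$ (which is again distance-regular when $d\ge 3$) then has the antipodal classes as its vertices, two distinct classes being adjacent if and only if they contain adjacent vertices of $\Gamma$. Let $M(\overline\Gamma)$ be the maximum size of a set of vertices at a given distance from any vertex of $\overline\Gamma$, that is,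 $M(\overline\Gamma)=\max_{v,i}|\{w : \mathrm{d}_{\overline\Gamma}(v,w)=i\}|$. Suppose $\Gamma$ is a $t$-antipodal distance-regular graph with $n$ vertices and diameter $d\geq 4$ whose folded graph $\overline{\Gamma}$ is primitive and has diameter $\bar d\geq 2$. Then (i) $\displaystyle \mu(\Gamma) < (t-1)\left(4\sqrt{n/t}\,\log(n/t)+1\right)$; (ii) $\displaystyle \mu(\Gamma) < (t-1)\left(2\bar d\,\frac{n}{n-tM(\overline{\Gamma})}\,\log(n/t)+1\right)$. -/

import Mathlib

namespace SimpleGraph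

/-- A set `S` of vertices is resolving if distinct vertices are told apart by their distances
to the members of `S`. -/
def IsResolving {V : Type*} (Γ : SimpleGraph V) (S : Finset V) : Prop :=
  ∀ u w : V, (∀ s ∈ S, Γ.dist u s = Γ.dist w s) → u = w

/-- The metric dimension: the smallest size of a resolving set. -/
noncomputable def metricDimension {V : Type*} (Γ : SimpleGraph V) : ℕ :=
  sInf {m : ℕ | ∃ S : Finset V, Γ.IsResolving S ∧ S.card = m}

/-- A connected graph is distance-regular if for all vertices `u`, `v` the numbers `c`, `a`, `b` of
neighbours of `v` at distance `i - 1`, `i`, `i + 1` from `u`, where `i` is the distance from `u`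
to `v`, depend only on `i`. -/
def IsDistanceRegular {V : Type*} (Γ : SimpleGraph V) : Prop :=
  Γ.Connected ∧ ∃ c a b : ℕ → ℕ, ∀ u v : V,
    {w | Γ.Adj v w ∧ Γ.dist u w + 1 = Γ.dist u v}.ncard = c (Γ.dist u v) ∧
    {w | Γ.Adj v w ∧ Γ.dist u w = Γ.dist u v}.ncard = a (Γ.dist u v) ∧
    {w | Γ.Adj v w ∧ Γ.dist u w = Γ.dist u v + 1}.ncard = b (Γ.dist u v)

/-- The distance-`i` graph: two distinct vertices are adjacent if their distance is `i`. -/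
def distanceGraph {V : Type*} (Γ : SimpleGraph V) (i : ℕ) : SimpleGraph V where
  Adj u v := u ≠ v ∧ Γ.dist u v = i
  symm := ⟨fun _ _ h => ⟨h.1.symm, by rw [dist_comm]; exact h.2⟩⟩
  loopless := ⟨fun _ h => h.1 rfl⟩

/-- The primitivity condition: the distance-`i` graphs, `0 < i ≤ diam`, are all connected. -/
def IsPrimitive {V : Type*} (Γ : SimpleGraph V) : Prop :=
  ∀ i : ℕ, 0 < i → i ≤ Γ.diam → (Γ.distanceGraph i).Connected

/-- The relation of being at distance `0` or `diam`. -/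
def AntipodalRel {V : Type*} (Γ : SimpleGraph V) (u v : V) : Prop :=
  Γ.dist u v = 0 ∨ Γ.dist u v = Γ.diam

/-- `Γ` is `t`-antipodal: being at distance `0` or `diam` is an equivalence relation all of whose
classes have size `t`. -/
structure IsAntipodal {V : Type*} (Γ : SimpleGraph V) (t : ℕ) : Prop where
  equivalence : Equivalence Γ.AntipodalRel
  ncard_class : ∀ v : V, {w | Γ.AntipodalRel v w}.ncard = t

/-- The setoid of antipodal classes. -/
def IsAntipodal.setoid {V : Type*} {Γ : SimpleGraph V} {t : ℕ} (h : Γ.IsAntipodal t) : Setoid V :=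
  ⟨Γ.AntipodalRel, h.equivalence⟩

/-- The folded graph: its vertices are the antipodal classes, and two distinct classes are adjacent
if they contain adjacent vertices. -/
def IsAntipodal.foldedGraph {V : Type*} {Γ : SimpleGraph V} {t : ℕ} (h : Γ.IsAntipodal t) :
    SimpleGraph (Quotient h.setoid) where
  Adj C D := C ≠ D ∧
    ∃ u v : V, Quotient.mk h.setoid u = C ∧ Quotient.mk h.setoid v = D ∧ Γ.Adj u v
  symm := ⟨fun _ _ ⟨hne, u, v, hu, hv, huv⟩ => ⟨hne.symm, v, u, hv, hu, huv.symm⟩⟩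
  loopless := ⟨fun _ h => h.1 rfl⟩

/-- The maximum size of a set of vertices at a given distance from any vertex (of a finite
graph). -/
noncomputable def maxDistanceClass {V : Type*} (Γ : SimpleGraph V) : ℕ :=
  sSup {m : ℕ | ∃ (v : V) (i : ℕ), {w | Γ.dist v w = i}.ncard = m}

end SimpleGraph

namespace SimpleGraph

open Finset Classical

/-! The folded graph is primitive and distance-regular on $N=n/t$ vertices, so Babai's argument
gives it a small resolving set; this set is then lifted to $\Gamma$.

Babai's argument. If any two distinct vertices are distinguished by at least $D\le N/2$ vertices,
greedy choice gives a resolving set of size less than $2N\log N/D$ (`exists_isResolving_card_lt`).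
The number of distinguishers of a pair depends only on its distance $i$ and satisfies the triangle
inequality. Since the distance-$i$ graph is connected, even the best distinguished pair is joined to
any other by a path of pairs at distance $i$, so no distance can have few distinguishers. This
yields $D=(N-M)/\bar d$ (`IsPrimitive.card_sub_le_diam_mul`) and $D=\sqrt N/2$
(`IsPrimitive.card_le_four_mul_sq`).

Lifting. In $\Gamma$ the distance between classes is $\min(k,d-k)$, where $k$ is the distance of any
representatives (`IsAntipodal.foldedGraph_dist`). Hence all but one vertex of each class of a
resolving set separate vertices in different classes; vertices in one class are separated once every
class is at distance less than $d/2$ from a chosen class, which costs at most one extra class. This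
gives the factor $t-1$ and the summand $1$ (`IsAntipodal.metricDimension_le_of_isResolving`). -/

/-! ### Greedy construction of resolving sets. -/

/-- The vertices whose distances to `x` and `y` differ. -/
noncomputable def distinguishers {V : Type*} [Fintype V] (Γ : SimpleGraph V) (x y : V) :
    Finset V :=
  {z | Γ.dist x z ≠ Γ.dist y z}

theorem mem_distinguishers {V : Type*} [Fintype V] {Γ : SimpleGraph V} {x y z : V} :
    z ∈ Γ.distinguishers x y ↔ Γ.dist x z ≠ Γ.dist y z := by
  simp [distinguishers]

/-- The ordered pairs of distinct vertices that `S` does not tell apart. -/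
noncomputable def unresolvedPairs {V : Type*} [Fintype V] (Γ : SimpleGraph V) (S : Finset V) :
    Finset (V × V) :=
  {p | p.1 ≠ p.2 ∧ ∀ s ∈ S, Γ.dist p.1 s = Γ.dist p.2 s}

theorem unresolvedPairs_insert {V : Type*} [Fintype V] (Γ : SimpleGraph V) (S : Finset V) (z : V) :
    Γ.unresolvedPairs (insert z S) =
      {p ∈ Γ.unresolvedPairs S | ¬ z ∈ Γ.distinguishers p.1 p.2} := by
  ext p
  simp only [unresolvedPairs, mem_filter, mem_univ, true_and, mem_insert, forall_eq_or_imp,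
    mem_distinguishers, not_not]
  tauto

/-- Averaging: each unresolved pair is separated by at least $D$ vertices, so some vertex separates
at least a proportion $D/|V|$ of these pairs. -/
theorem exists_card_unresolvedPairs_insert_le {V : Type*} [Fintype V] [Nonempty V]
    (Γ : SimpleGraph V) {D : ℝ}
    (h : ∀ x y, x ≠ y → D ≤ #(Γ.distinguishers x y)) (S : Finset V) :
    ∃ z, (#(Γ.unresolvedPairs (insert z S)) : ℝ) ≤
      #(Γ.unresolvedPairs S) * (1 - D / Fintype.card V) := by
  set P := Γ.unresolvedPairs S with hP
  have hn : (0 : ℝ) < Fintype.card V := by exact_mod_cast Fintype.card_pos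
  have key : (#P : ℝ) * D ≤ ∑ z : V, (#{p ∈ P | z ∈ Γ.distinguishers p.1 p.2} : ℝ) := by
    have hcount : ∑ z : V, #{p ∈ P | z ∈ Γ.distinguishers p.1 p.2}
        = ∑ p ∈ P, #(Γ.distinguishers p.1 p.2) := by
      simp only [card_filter]
      rw [sum_comm]
      refine sum_congr rfl fun p _ => ?_
      rw [← card_filter]
      congr 1
      ext z
      simp
    rw [← Nat.cast_sum, hcount, Nat.cast_sum, ← nsmul_eq_mul]
    refine card_nsmul_le_sum _ _ _ fun p hp => h _ _ ?_
    simp only [hP, unresolvedPairs, mem_filter] at hp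
    exact hp.2.1
  obtain ⟨z, -, hz⟩ : ∃ z ∈ (univ : Finset V),
      (#P : ℝ) * D / Fintype.card V ≤ #{p ∈ P | z ∈ Γ.distinguishers p.1 p.2} := by
    refine exists_le_of_sum_le univ_nonempty ?_
    rw [sum_const, card_univ, nsmul_eq_mul, mul_div_cancel₀ _ hn.ne']
    exact key
  refine ⟨z, ?_⟩
  have hsplit : #{p ∈ P | z ∈ Γ.distinguishers p.1 p.2}
      + #(Γ.unresolvedPairs (insert z S)) = #P := by
    rw [unresolvedPairs_insert]
    exact card_filter_add_card_filter_not _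
  have hsplit' : (#{p ∈ P | z ∈ Γ.distinguishers p.1 p.2} : ℝ)
      + #(Γ.unresolvedPairs (insert z S)) = #P := by exact_mod_cast hsplit
  have : (#P : ℝ) * (1 - D / Fintype.card V) = #P - #P * D / Fintype.card V := by ring
  linarith

theorem exists_card_unresolvedPairs_le {V : Type*} [Fintype V] [Nonempty V]
    (Γ : SimpleGraph V) {D : ℝ} (hD : D ≤ Fintype.card V)
    (h : ∀ x y, x ≠ y → D ≤ #(Γ.distinguishers x y)) (m : ℕ) :
    ∃ S : Finset V, #S ≤ m ∧ (#(Γ.unresolvedPairs S) : ℝ) ≤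
      (Fintype.card V * (Fintype.card V - 1)) * (1 - D / Fintype.card V) ^ m := by
  have hn : (0 : ℝ) < Fintype.card V := by exact_mod_cast Fintype.card_pos
  induction m with
  | zero =>
    refine ⟨∅, by simp, ?_⟩
    have : Γ.unresolvedPairs ∅ = (univ : Finset V).offDiag := by
      ext p; simp [unresolvedPairs]
    rw [this, offDiag_card, card_univ, Nat.cast_sub (Nat.le_mul_self _)]
    push_cast
    linarith
  | succ m ih =>
    obtain ⟨S, hS, hP⟩ := ih
    obtain ⟨z, hz⟩ := Γ.exists_card_unresolvedPairs_insert_le h S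
    refine ⟨insert z S, (card_insert_le _ _).trans (by omega), hz.trans ?_⟩
    rw [pow_succ, ← mul_assoc]
    refine mul_le_mul_of_nonneg_right hP ?_
    rw [sub_nonneg]
    exact div_le_one_of_le₀ hD hn.le

/-- If any two vertices have many distinguishers, then a greedily chosen set resolves. -/
theorem exists_isResolving_card_lt {V : Type*} [Fintype V] (Γ : SimpleGraph V) {D : ℝ}
    (hV : 2 ≤ Fintype.card V) (hD0 : 0 < D) (hD : D ≤ Fintype.card V / 2)
    (h : ∀ x y, x ≠ y → D ≤ #(Γ.distinguishers x y)) :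
    ∃ S : Finset V, Γ.IsResolving S ∧
      (#S : ℝ) < 2 * Fintype.card V * Real.log (Fintype.card V) / D := by
  set n : ℝ := (Fintype.card V : ℝ) with hndef
  have hn : (2 : ℝ) ≤ n := by rw [hndef]; exact_mod_cast hV
  have : Nonempty V := Fintype.card_pos_iff.1 (by omega)
  have hlog : 0 < Real.log n := Real.log_pos (by linarith)
  set B : ℝ := 2 * n * Real.log n / D with hB
  have hB0 : 0 < B := by positivity
  -- Taking $m=\lceil B\rceil-1$ steps makes the bound strict. The missing factor $1-D/n$ is at
  -- least $1/2$ as $D\le n/2$, so fewer than $2$ unresolved pairs remain; ordered pairs come in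
  -- twos, so none remains.
  obtain ⟨m, hm⟩ : ∃ m, ⌈B⌉₊ = m + 1 :=
    Nat.exists_eq_succ_of_ne_zero (Nat.ceil_pos.2 hB0).ne'
  have hmB : (m : ℝ) < B := Nat.lt_ceil.1 (by omega)
  have hBm : B ≤ m + 1 := by exact_mod_cast hm ▸ Nat.le_ceil B
  obtain ⟨S, hS, hP⟩ := Γ.exists_card_unresolvedPairs_le (by linarith : D ≤ n) h m
  refine ⟨S, ?_, lt_of_le_of_lt (by exact_mod_cast hS) hmB⟩
  have hq : 1 / 2 ≤ 1 - D / n := by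
    have : D / n ≤ 1 / 2 := by rw [div_le_iff₀ (by linarith)]; linarith
    linarith
  have hpow : (1 - D / n) ^ (m + 1) ≤ 1 / n ^ 2 := by
    have h1 : 1 - D / n ≤ Real.exp (-(D / n)) := by
      have := Real.add_one_le_exp (-(D / n)); linarith
    calc (1 - D / n) ^ (m + 1) ≤ Real.exp (-(D / n)) ^ (m + 1) :=
          pow_le_pow_left₀ (by linarith) h1 _
      _ = Real.exp (-((m + 1) * (D / n))) := by
          rw [← Real.exp_nat_mul]; push_cast; ring_nf
      _ ≤ Real.exp (-(2 * Real.log n)) := by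
          refine Real.exp_le_exp.2 (neg_le_neg ?_)
          calc 2 * Real.log n = B * (D / n) := by rw [hB]; field_simp
            _ ≤ (m + 1) * (D / n) := mul_le_mul_of_nonneg_right hBm (by positivity)
      _ = 1 / n ^ 2 := by
          rw [Real.exp_neg, show 2 * Real.log n = Real.log (n ^ 2) by simp,
            Real.exp_log (by positivity), one_div]
  have hlt : (#(Γ.unresolvedPairs S) : ℝ) < 2 := by
    have h2 : (1 - D / n) ^ m ≤ 2 / n ^ 2 := by
      have h3 : (1 - D / n) ^ m * (1 / 2) ≤ 1 / n ^ 2 := by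
        refine le_trans ?_ hpow
        rw [pow_succ]
        exact mul_le_mul_of_nonneg_left hq (pow_nonneg (by linarith) _)
      have : 2 / n ^ 2 = 2 * (1 / n ^ 2) := by ring
      linarith
    calc (#(Γ.unresolvedPairs S) : ℝ) ≤ (n * (n - 1)) * (1 - D / n) ^ m := hP
      _ ≤ (n * (n - 1)) * (2 / n ^ 2) :=
          mul_le_mul_of_nonneg_left h2 (mul_nonneg (by linarith) (by linarith))
      _ = 2 - 2 / n := by field_simp
      _ < 2 := by have : 0 < 2 / n := by positivity
                  linarith
  have hlt' : #(Γ.unresolvedPairs S) < 2 := by exact_mod_cast hlt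
  intro u w huw
  by_contra hne
  have hmem : (u, w) ∈ Γ.unresolvedPairs S := by
    simp only [unresolvedPairs, mem_filter, mem_univ, true_and]
    exact ⟨hne, huw⟩
  have hmem' : (w, u) ∈ Γ.unresolvedPairs S := by
    simp only [unresolvedPairs, mem_filter, mem_univ, true_and]
    exact ⟨Ne.symm hne, fun s hs => (huw s hs).symm⟩
  have := card_le_one.1 (Nat.lt_succ_iff.1 hlt') _ hmem _ hmem'
  exact hne (Prod.mk.inj this).1

/-! ### Intersection numbers of a distance-regular graph. -/

/-- The number of vertices at given distances from two vertices depends only on the distance of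
these. -/
def HasIntersectionNumbers {V : Type*} [Fintype V] (Γ : SimpleGraph V) : Prop :=
  ∀ i j : ℕ, ∀ x y x' y' : V, Γ.dist x y = Γ.dist x' y' →
    #{z | Γ.dist x z = i ∧ Γ.dist y z = j} = #{z | Γ.dist x' z = i ∧ Γ.dist y' z = j}

/-- The adjacency matrix of the graph of pairs of vertices at distance `i`. -/
noncomputable def distMatrix {V : Type*} (Γ : SimpleGraph V) (i : ℕ) : Matrix V V ℚ :=
  Matrix.of fun x y => if Γ.dist x y = i then 1 else 0

/-- A matrix whose entries depend only on the distance of the indices. -/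
def IsDistInvariant {V : Type*} (Γ : SimpleGraph V) (M : Matrix V V ℚ) : Prop :=
  ∃ f : ℕ → ℚ, ∀ x y, M x y = f (Γ.dist x y)

/-- The three-term rule for multiplying a distance-invariant matrix by the adjacency matrix. The
clause on `c` permits division by `c i` for every positive distance that occurs. -/
theorem IsDistanceRegular.exists_adjacency_mul {V : Type*} [Fintype V] {Γ : SimpleGraph V}
    (h : Γ.IsDistanceRegular) : ∃ c a b : ℕ → ℚ, (∀ i, c i = 0 → Γ.distMatrix i = 0 ∨ i = 0) ∧
      ∀ (f : ℕ → ℚ) (x y : V), ∑ w, (if Γ.Adj y w then f (Γ.dist x w) else 0) =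
        (if Γ.dist x y = 0 then 0 else c (Γ.dist x y) * f (Γ.dist x y - 1))
        + a (Γ.dist x y) * f (Γ.dist x y)
        + b (Γ.dist x y) * f (Γ.dist x y + 1) := by
  obtain ⟨hconn, c, a, b, hcab⟩ := h
  refine ⟨fun i => c i, fun i => a i, fun i => b i, ?_, ?_⟩
  · intro i hi
    beta_reduce at hi
    by_contra! hcon
    obtain ⟨hne, hi0⟩ := hcon
    have : ∃ x y, Γ.dist x y = i := by
      by_contra! hall
      exact hne (by ext x y; simp [distMatrix, hall])
    obtain ⟨x, y, hxy⟩ := this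
    obtain ⟨p, hp⟩ := (hconn.preconnected y x).exists_walk_length_eq_dist
    rw [dist_comm, hxy] at hp
    cases p with
    | nil => simp at hp; omega
    | @cons _ w _ hadj q =>
      have h1 : Γ.dist x w + 1 = Γ.dist x y := by
        rw [hxy, ← hp, Walk.length_cons]
        have h2 : Γ.dist x w ≤ q.length := by rw [dist_comm]; exact dist_le q
        have h3 : Γ.dist x y ≤ Γ.dist x w + Γ.dist w y := hconn.dist_triangle
        have h4 : Γ.dist w y = 1 := dist_eq_one_iff_adj.2 hadj.symm
        rw [hxy, ← hp, Walk.length_cons] at h3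
        omega
      have hc := (hcab x y).1
      rw [hxy] at hc
      have hc0 : c i = 0 := by exact_mod_cast hi
      rw [hc0, Set.ncard_eq_zero] at hc
      have hw : w ∈ ({w | Γ.Adj y w ∧ Γ.dist x w + 1 = i} : Set V) := ⟨hadj, hxy ▸ h1⟩
      rw [hc] at hw
      exact hw
  · intro f x y
    beta_reduce
    obtain ⟨h1, h2, h3⟩ := hcab x y
    have hset : ∀ (p : V → Prop) [DecidablePred p],
        {w | Γ.Adj y w ∧ p w}.ncard = #{w | Γ.Adj y w ∧ p w} := by
      intro p _
      rw [← Set.ncard_coe_finset]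
      simp
    rw [hset] at h1 h2 h3
    rw [← h1, ← h2, ← h3]
    have hsum : ∀ (p : V → Prop) [DecidablePred p] (r : ℚ),
        (#{w | Γ.Adj y w ∧ p w} : ℚ) * r = ∑ w, if Γ.Adj y w ∧ p w then r else 0 := by
      intro p _ r
      rw [← sum_filter, sum_const, nsmul_eq_mul]
    have hc0 : (if Γ.dist x y = 0 then 0 else
        (#{w | Γ.Adj y w ∧ Γ.dist x w + 1 = Γ.dist x y} : ℚ) * f (Γ.dist x y - 1)) =
        (#{w | Γ.Adj y w ∧ Γ.dist x w + 1 = Γ.dist x y} : ℚ) * f (Γ.dist x y - 1) := by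
      split_ifs with h0
      · simp [h0]
      · rfl
    rw [hc0, hsum, hsum, hsum, ← sum_add_distrib, ← sum_add_distrib]
    refine sum_congr rfl fun w _ => ?_
    by_cases hadj : Γ.Adj y w
    · have hyw : Γ.dist y w = 1 := dist_eq_one_iff_adj.2 hadj
      have t1 : Γ.dist x w ≤ Γ.dist x y + Γ.dist y w := hconn.dist_triangle
      have t2 : Γ.dist x y ≤ Γ.dist x w + Γ.dist w y := hconn.dist_triangle
      rw [dist_comm (u := w)] at t2
      simp only [hadj, true_and, if_true]
      rcases (by omega : Γ.dist x w + 1 = Γ.dist x y ∨ Γ.dist x w = Γ.dist x y ∨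
        Γ.dist x w = Γ.dist x y + 1) with h | h | h
      · have e : Γ.dist x y - 1 = Γ.dist x w := by omega
        rw [e, if_pos h, if_neg (by omega), if_neg (by omega)]; ring
      · rw [if_neg (by omega), if_pos h, if_neg (by omega), h]; ring
      · rw [if_neg (by omega), if_neg (by omega), if_pos h, h]; ring
    · simp [hadj]

/-- Right multiplication by the adjacency matrix preserves distance-invariance, and the three-term
recurrence `hrec` builds every distance matrix from that matrix. -/
theorem IsDistanceRegular.isDistInvariant_mul {V : Type*} [Fintype V] {Γ : SimpleGraph V}
    (h : Γ.IsDistanceRegular) (i : ℕ) {M : Matrix V V ℚ} (hM : Γ.IsDistInvariant M) :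
    Γ.IsDistInvariant (M * Γ.distMatrix i) := by
  obtain ⟨c, a, b, hc, hcab⟩ := h.exists_adjacency_mul
  let A : Matrix V V ℚ := Matrix.of fun x y => if Γ.Adj x y then 1 else 0
  have hA : ∀ x y, A x y = if Γ.Adj x y then 1 else 0 := fun _ _ => rfl
  have hstep : ∀ {M : Matrix V V ℚ}, Γ.IsDistInvariant M → Γ.IsDistInvariant (M * A) := by
    rintro M ⟨f, hf⟩
    refine ⟨fun k => (if k = 0 then 0 else c k * f (k - 1)) + a k * f k + b k * f (k + 1),
      fun x y => ?_⟩
    beta_reduce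
    rw [← hcab f x y, Matrix.mul_apply]
    refine sum_congr rfl fun w _ => ?_
    simp only [hA, hf, mul_ite, mul_one, mul_zero, adj_comm]
  have hrec : ∀ i, c (i + 1) • Γ.distMatrix (i + 1) = Γ.distMatrix i * A - a i • Γ.distMatrix i
      - (if i = 0 then 0 else b (i - 1) • Γ.distMatrix (i - 1)) := by
    intro i
    ext x y
    have := hcab (fun k => if k = i then 1 else 0) x y
    have e : (Γ.distMatrix i * A) x y =
        ∑ w, (if Γ.Adj y w then (if Γ.dist x w = i then 1 else 0) else 0) := by
      rw [Matrix.mul_apply]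
      refine sum_congr rfl fun w _ => ?_
      simp only [hA, distMatrix, Matrix.of_apply, mul_ite, mul_one, mul_zero, adj_comm]
    have e4 : (if i = 0 then (0 : Matrix V V ℚ) else b (i - 1) • Γ.distMatrix (i - 1)) x y =
        if i = 0 then 0 else b (i - 1) * if Γ.dist x y = i - 1 then 1 else 0 := by
      split_ifs <;> simp_all [distMatrix]
    rw [Matrix.sub_apply, Matrix.sub_apply, e, this, e4]
    simp only [Matrix.smul_apply, distMatrix, Matrix.of_apply, smul_eq_mul]
    generalize Γ.dist x y = k
    have e1 : (if k = 0 then 0 else c k * if k - 1 = i then 1 else 0) =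
        c (i + 1) * if k = i + 1 then 1 else 0 := by grind
    have e2 : (a k * if k = i then 1 else 0) = a i * if k = i then 1 else 0 := by grind
    have e3 : (b k * if k + 1 = i then 1 else 0) =
        if i = 0 then 0 else b (i - 1) * if k = i - 1 then 1 else 0 := by grind
    rw [e1, e2, e3]
    ring
  -- Two consecutive indices are carried because the recurrence looks back two steps.
  have hmain : ∀ i, Γ.IsDistInvariant (M * Γ.distMatrix i) ∧
      Γ.IsDistInvariant (M * Γ.distMatrix (i + 1)) := by
    have hsucc : ∀ i, Γ.IsDistInvariant (M * Γ.distMatrix i) →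
        Γ.IsDistInvariant (M * if i = 0 then 0 else b (i - 1) • Γ.distMatrix (i - 1)) →
        Γ.IsDistInvariant (M * Γ.distMatrix (i + 1)) := by
      intro i h1 h2
      by_cases hci : c (i + 1) = 0
      · rcases hc _ hci with h0 | h0
        · rw [h0, Matrix.mul_zero]
          exact ⟨fun _ => 0, fun _ _ => rfl⟩
        · omega
      · have e : Γ.distMatrix (i + 1) = (c (i + 1))⁻¹ • (Γ.distMatrix i * A
            - a i • Γ.distMatrix i
            - (if i = 0 then 0 else b (i - 1) • Γ.distMatrix (i - 1))) := by
          rw [← hrec, smul_smul, inv_mul_cancel₀ hci, one_smul]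
        rw [e, Matrix.mul_smul, Matrix.mul_sub, Matrix.mul_sub, ← Matrix.mul_assoc,
          Matrix.mul_smul]
        obtain ⟨f1, hf1⟩ := h1
        obtain ⟨f2, hf2⟩ := h2
        obtain ⟨f3, hf3⟩ := hstep ⟨f1, hf1⟩
        refine ⟨fun k => (c (i + 1))⁻¹ * (f3 k - a i * f1 k - f2 k), fun x y => ?_⟩
        rw [Matrix.smul_apply, Matrix.sub_apply, Matrix.sub_apply, Matrix.smul_apply, hf1, hf2,
          hf3, smul_eq_mul, smul_eq_mul]
    intro i
    induction i with
    | zero =>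
      have h0 : Γ.distMatrix 0 = 1 := by
        ext x y
        simp [distMatrix, Matrix.one_apply, h.1.dist_eq_zero_iff]
      have h1 : Γ.IsDistInvariant (M * Γ.distMatrix 0) := by rwa [h0, Matrix.mul_one]
      refine ⟨h1, hsucc 0 h1 ?_⟩
      rw [if_pos rfl, Matrix.mul_zero]
      exact ⟨fun _ => 0, fun _ _ => rfl⟩
    | succ i ih =>
      refine ⟨ih.2, hsucc _ ih.2 ?_⟩
      obtain ⟨f, hf⟩ := ih.1
      rw [if_neg (Nat.succ_ne_zero i), Matrix.mul_smul]
      exact ⟨fun k => b i * f k, fun x y => by simp [Matrix.smul_apply, hf]⟩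
  exact (hmain i).1

theorem IsDistanceRegular.hasIntersectionNumbers {V : Type*} [Fintype V] {Γ : SimpleGraph V}
    (h : Γ.IsDistanceRegular) : Γ.HasIntersectionNumbers := by
  intro i j x y x' y' hxy
  obtain ⟨f, hf⟩ := h.isDistInvariant_mul j (M := Γ.distMatrix i)
    ⟨fun k => if k = i then 1 else 0, fun _ _ => rfl⟩
  have key : ∀ x y, (#{z | Γ.dist x z = i ∧ Γ.dist y z = j} : ℚ) = f (Γ.dist x y) := by
    intro x y
    rw [← hf, Matrix.mul_apply, ← nsmul_one, ← sum_const, sum_filter]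
    refine sum_congr rfl fun z _ => ?_
    simp only [distMatrix, Matrix.of_apply, dist_comm (u := z), ite_and, mul_ite, mul_one,
      mul_zero]
    grind
  have := (key x y).trans ((congrArg f hxy).trans (key x' y').symm)
  exact_mod_cast this

/-! ### Geodesics and transfer of distance configurations. -/

theorem Connected.exists_dist_eq_of_le {V : Type*} {Γ : SimpleGraph V} (hc : Γ.Connected)
    {x y : V} {i : ℕ} (hi : i ≤ Γ.dist x y) :
    ∃ z, Γ.dist x z = i ∧ Γ.dist y z = Γ.dist x y - i := by
  obtain ⟨p, hp⟩ := (hc.preconnected x y).exists_walk_length_eq_dist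
  refine ⟨p.getVert i, ?_⟩
  have h1 : Γ.dist x (p.getVert i) ≤ i := (dist_le (p.take i)).trans (by simp [Walk.take_length])
  have h2 : Γ.dist (p.getVert i) y ≤ Γ.dist x y - i :=
    (dist_le (p.drop i)).trans (by simp [Walk.drop_length, hp])
  have h3 : Γ.dist x y ≤ Γ.dist x (p.getVert i) + Γ.dist (p.getVert i) y := hc.dist_triangle
  rw [dist_comm (u := y)]
  omega

theorem HasIntersectionNumbers.exists_congr {V : Type*} [Fintype V] {Γ : SimpleGraph V}
    (h : Γ.HasIntersectionNumbers) {x y x' y' : V} (hxy : Γ.dist x y = Γ.dist x' y') (z : V) :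
    ∃ z', Γ.dist x' z' = Γ.dist x z ∧ Γ.dist y' z' = Γ.dist y z := by
  have h1 := h (Γ.dist x z) (Γ.dist y z) x y x' y' hxy
  have h2 : 0 < #{w | Γ.dist x w = Γ.dist x z ∧ Γ.dist y w = Γ.dist y z} :=
    card_pos.2 ⟨z, by simp⟩
  rw [h1] at h2
  obtain ⟨z', hz'⟩ := card_pos.1 h2
  exact ⟨z', by simpa using hz'⟩

theorem Connected.dist_le_diam {V : Type*} [Finite V] {Γ : SimpleGraph V} (hc : Γ.Connected)
    (x y : V) : Γ.dist x y ≤ Γ.diam := by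
  have := hc.nonempty
  exact SimpleGraph.dist_le_diam (connected_iff_ediam_ne_top.1 hc)

/-- Geodesics extend to geodesics whose length is the diameter. -/
theorem HasIntersectionNumbers.exists_dist_eq_diam {V : Type*} [Fintype V] {Γ : SimpleGraph V}
    (h : Γ.HasIntersectionNumbers) (hc : Γ.Connected) (x y : V) :
    ∃ z, Γ.dist x z = Γ.diam ∧ Γ.dist y z = Γ.diam - Γ.dist x y := by
  have := hc.nonempty
  obtain ⟨p, q, hpq⟩ := Γ.exists_dist_eq_diam
  obtain ⟨v, hv1, hv2⟩ := hc.exists_dist_eq_of_le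
    (hpq ▸ hc.dist_le_diam x y : Γ.dist x y ≤ Γ.dist p q)
  obtain ⟨z, hz1, hz2⟩ := h.exists_congr hv1 q
  exact ⟨z, by omega, by rw [hz2, dist_comm, hv2, hpq]⟩

/-! ### Distances in the folded graph. -/

section Antipodal

variable {V : Type*} {Γ : SimpleGraph V} {t : ℕ}

theorem AntipodalRel.dist_eq_diam (hc : Γ.Connected) {u z : V}
    (hr : Γ.AntipodalRel u z) (hne : u ≠ z) : Γ.dist u z = Γ.diam :=
  hr.resolve_left fun h0 => hne (hc.dist_eq_zero_iff.1 h0)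

theorem IsAntipodal.mk_eq_mk_iff (hanti : Γ.IsAntipodal t) {u v : V} :
    Quotient.mk hanti.setoid u = Quotient.mk hanti.setoid v ↔ Γ.AntipodalRel u v :=
  Quotient.eq

theorem IsAntipodal.foldedGraph_adj_mk (hanti : Γ.IsAntipodal t) (hd : 2 ≤ Γ.diam) {u v : V}
    (huv : Γ.Adj u v) :
    hanti.foldedGraph.Adj (Quotient.mk hanti.setoid u) (Quotient.mk hanti.setoid v) := by
  refine ⟨fun he => ?_, u, v, rfl, rfl, huv⟩
  have h1 := dist_eq_one_iff_adj.2 huv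
  rcases hanti.mk_eq_mk_iff.1 he with h | h <;> omega

/-- The projection onto the folded graph. -/
def IsAntipodal.foldHom (hanti : Γ.IsAntipodal t) (hd : 2 ≤ Γ.diam) : Γ →g hanti.foldedGraph where
  toFun := Quotient.mk hanti.setoid
  map_rel' := hanti.foldedGraph_adj_mk hd

theorem IsAntipodal.foldedGraph_connected (hanti : Γ.IsAntipodal t) (hc : Γ.Connected)
    (hd : 2 ≤ Γ.diam) : hanti.foldedGraph.Connected := by
  have : Nonempty (Quotient hanti.setoid) := hc.nonempty.map (Quotient.mk _)
  refine ⟨fun C D => ?_⟩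
  induction C using Quotient.inductionOn with | _ u
  induction D using Quotient.inductionOn with | _ v
  exact (hc.preconnected u v).map (hanti.foldHom hd)

theorem IsAntipodal.foldedGraph_dist_le (hanti : Γ.IsAntipodal t) (hc : Γ.Connected)
    (hd : 2 ≤ Γ.diam) (u v : V) :
    hanti.foldedGraph.dist (Quotient.mk hanti.setoid u) (Quotient.mk hanti.setoid v) ≤
      Γ.dist u v := by
  obtain ⟨p, hp⟩ := (hc.preconnected u v).exists_walk_length_eq_dist
  rw [← hp, ← Walk.length_map (hanti.foldHom hd) p]
  exact dist_le (p.map (hanti.foldHom hd))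

variable [Fintype V]

/-- If $v$ were farther from $z$, a geodesic from $z$ through $v$ prolonged to length $d$ would end
at some $y\ne u$ in the class of $u$, and the path from $u$ through $v$ to $y$ would be shorter than
$d$. -/
theorem IsAntipodal.dist_eq_diam_sub (hanti : Γ.IsAntipodal t) (h : Γ.HasIntersectionNumbers)
    (hc : Γ.Connected) {u v z : V} (hr : Γ.AntipodalRel u z) (hne : u ≠ z)
    (huv : 2 * Γ.dist u v ≤ Γ.diam) : Γ.dist v z = Γ.diam - Γ.dist u v := by
  have huz := AntipodalRel.dist_eq_diam hc hr hne
  have t1 : Γ.dist u z ≤ Γ.dist u v + Γ.dist v z := hc.dist_triangle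
  by_contra hcon
  obtain ⟨y, hy1, hy2⟩ := h.exists_dist_eq_diam hc z v
  have hle := hc.dist_le_diam z v
  rw [dist_comm (u := z) (v := v)] at hy2 hle
  have hry : Γ.AntipodalRel u y := hanti.equivalence.trans hr (Or.inr hy1)
  have hney : u ≠ y := by
    rintro rfl
    rw [dist_comm (u := v)] at hy2
    omega
  have huy := AntipodalRel.dist_eq_diam hc hry hney
  have t2 : Γ.dist u y ≤ Γ.dist u v + Γ.dist v y := hc.dist_triangle
  omega

theorem IsAntipodal.dist_eq_or (hanti : Γ.IsAntipodal t) (h : Γ.HasIntersectionNumbers)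
    (hc : Γ.Connected) {v v' : V} (u : V) (hr : Γ.AntipodalRel v v') :
    Γ.dist u v' = Γ.dist u v ∨ Γ.dist u v' = Γ.diam - Γ.dist u v := by
  rcases eq_or_ne v v' with rfl | hne
  · exact Or.inl rfl
  rcases le_or_gt (2 * Γ.dist v u) Γ.diam with hle | hlt
  · right
    rw [hanti.dist_eq_diam_sub h hc hr hne hle, dist_comm]
  · obtain ⟨z, hz1, hz2⟩ := h.exists_dist_eq_diam hc v u
    have hd := hc.dist_le_diam v u
    rcases eq_or_ne z v' with rfl | hne'
    · right; rw [hz2, dist_comm]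
    · left
      have hrz : Γ.AntipodalRel z v' :=
        hanti.equivalence.trans (hanti.equivalence.symm (Or.inr hz1)) hr
      have := hanti.dist_eq_diam_sub h hc (v := u) hrz hne' (by rw [dist_comm, hz2]; omega)
      rw [this, dist_comm, hz2, dist_comm (u := u) (v := v)]
      omega

theorem IsAntipodal.exists_near (hanti : Γ.IsAntipodal t) (h : Γ.HasIntersectionNumbers)
    (hc : Γ.Connected) (u v : V) :
    ∃ v', Γ.AntipodalRel v v' ∧ Γ.dist u v' = min (Γ.dist u v) (Γ.diam - Γ.dist u v) := by
  rcases le_or_gt (2 * Γ.dist u v) Γ.diam with hle | hlt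
  · exact ⟨v, hanti.equivalence.refl v, by omega⟩
  · obtain ⟨z, hz1, hz2⟩ := h.exists_dist_eq_diam hc v u
    refine ⟨z, Or.inr hz1, ?_⟩
    rw [hz2, dist_comm (u := v)]
    omega

/-- A walk lifts from any starting representative: distances from $v_0$ to the class of its
neighbour $u_0$ are only $1$ or $d-1$, so each representative $u$ has a vertex of the class of $v_0$
within distance $1$. -/
theorem IsAntipodal.exists_dist_le_length (hanti : Γ.IsAntipodal t) (h : Γ.HasIntersectionNumbers)
    (hc : Γ.Connected) {C D : Quotient hanti.setoid}
    (p : hanti.foldedGraph.Walk C D) (u : V) (hu : Quotient.mk hanti.setoid u = C) :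
    ∃ v, Quotient.mk hanti.setoid v = D ∧ Γ.dist u v ≤ p.length := by
  induction p generalizing u with
  | nil => exact ⟨u, hu, by simp⟩
  | cons hadj p ih =>
    obtain ⟨u₀, v₀, hu₀, hv₀, hadj₀⟩ := hadj.2
    have hr : Γ.AntipodalRel u₀ u := hanti.mk_eq_mk_iff.1 (hu₀.trans hu.symm)
    obtain ⟨w, hw, hdw⟩ := hanti.exists_near h hc u v₀
    have h1 := dist_eq_one_iff_adj.2 hadj₀
    have h2 := hanti.dist_eq_or h hc v₀ hr
    rw [dist_comm (u := v₀) (v := u₀), h1, dist_comm] at h2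
    obtain ⟨v, hv, hdv⟩ := ih w ((hanti.mk_eq_mk_iff.2 (hanti.equivalence.symm hw)).trans hv₀)
    refine ⟨v, hv, ?_⟩
    have t1 : Γ.dist u v ≤ Γ.dist u w + Γ.dist w v := hc.dist_triangle
    rw [Walk.length_cons]
    omega

theorem IsAntipodal.foldedGraph_dist (hanti : Γ.IsAntipodal t) (h : Γ.HasIntersectionNumbers)
    (hc : Γ.Connected) (hd : 2 ≤ Γ.diam) (u v : V) :
    hanti.foldedGraph.dist (Quotient.mk hanti.setoid u) (Quotient.mk hanti.setoid v) =
      min (Γ.dist u v) (Γ.diam - Γ.dist u v) := by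
  refine le_antisymm ?_ ?_
  · obtain ⟨v', hv', hdv⟩ := hanti.exists_near h hc u v
    rw [← hdv, hanti.mk_eq_mk_iff.2 hv']
    exact hanti.foldedGraph_dist_le hc hd u v'
  · obtain ⟨p, hp⟩ := ((hanti.foldedGraph_connected hc hd).preconnected
      (Quotient.mk hanti.setoid u) (Quotient.mk hanti.setoid v)).exists_walk_length_eq_dist
    obtain ⟨v', hv', hle⟩ := hanti.exists_dist_le_length h hc p u rfl
    have := hanti.dist_eq_or h hc u (hanti.mk_eq_mk_iff.1 hv')
    have := hc.dist_le_diam u v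
    have := hc.dist_le_diam u v'
    omega

theorem IsAntipodal.card_fiber (hanti : Γ.IsAntipodal t) (C : Quotient hanti.setoid) :
    #{v | Quotient.mk hanti.setoid v = C} = t := by
  induction C using Quotient.inductionOn with | _ u
  refine Eq.trans ?_ (hanti.ncard_class u)
  rw [← Set.ncard_coe_finset]
  congr 1
  ext v
  simp only [coe_filter, mem_univ, true_and, Set.mem_ofPred_eq]
  exact hanti.mk_eq_mk_iff.trans ⟨fun h => hanti.equivalence.symm h,
    fun h => hanti.equivalence.symm h⟩

theorem IsAntipodal.card_filter_mk (hanti : Γ.IsAntipodal t) (T : Finset (Quotient hanti.setoid)) :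
    #{v | Quotient.mk hanti.setoid v ∈ T} = #T * t := by
  rw [card_eq_sum_card_fiberwise (f := Quotient.mk hanti.setoid) (t := T)
    fun v hv => by simpa using hv, ← smul_eq_mul, ← sum_const]
  refine sum_congr rfl fun C hC => ?_
  refine Eq.trans ?_ (hanti.card_fiber C)
  rw [filter_filter]
  congr 1
  ext v
  simp only [mem_filter, mem_univ, true_and, and_iff_right_iff_imp]
  rintro rfl
  exact hC

theorem IsAntipodal.card_eq (hanti : Γ.IsAntipodal t) [Fintype (Quotient hanti.setoid)] :
    Fintype.card V = Fintype.card (Quotient hanti.setoid) * t := by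
  have := hanti.card_filter_mk univ
  simpa using this

theorem IsAntipodal.two_le (hanti : Γ.IsAntipodal t) (hc : Γ.Connected) (hd : Γ.diam ≠ 0) :
    2 ≤ t := by
  have := hc.nonempty
  obtain ⟨p, q, hpq⟩ := Γ.exists_dist_eq_diam
  rw [← hanti.card_fiber (Quotient.mk _ p)]
  refine one_lt_card.2 ⟨p, by simp, q, ?_, ?_⟩
  · simp only [mem_filter, mem_univ, true_and]
    exact hanti.mk_eq_mk_iff.2 (hanti.equivalence.symm (Or.inr hpq))
  · rintro rfl
    simp at hpq
    omega

/-- Counted in $\Gamma$, a folded intersection number becomes a sum of intersection numbers of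
$\Gamma$, and is $t$ times too large. -/
theorem IsAntipodal.foldedGraph_hasIntersectionNumbers (hanti : Γ.IsAntipodal t)
    [Fintype (Quotient hanti.setoid)] (h : Γ.HasIntersectionNumbers) (hc : Γ.Connected)
    (hd : 2 ≤ Γ.diam) : hanti.foldedGraph.HasIntersectionNumbers := by
  have ht := hanti.two_le hc (by omega)
  have key : ∀ i j x y x' y', Γ.dist x y = Γ.dist x' y' →
      #{z | min (Γ.dist x z) (Γ.diam - Γ.dist x z) = i ∧
        min (Γ.dist y z) (Γ.diam - Γ.dist y z) = j} =
      #{z | min (Γ.dist x' z) (Γ.diam - Γ.dist x' z) = i ∧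
        min (Γ.dist y' z) (Γ.diam - Γ.dist y' z) = j} := by
    have hsum : ∀ i j x y, #{z | min (Γ.dist x z) (Γ.diam - Γ.dist x z) = i ∧
        min (Γ.dist y z) (Γ.diam - Γ.dist y z) = j} =
        ∑ k ∈ range (Γ.diam + 1) ×ˢ range (Γ.diam + 1) with
          min k.1 (Γ.diam - k.1) = i ∧ min k.2 (Γ.diam - k.2) = j,
          #{z | Γ.dist x z = k.1 ∧ Γ.dist y z = k.2} := by
      intro i j x y
      rw [card_eq_sum_card_fiberwise (f := fun z => (Γ.dist x z, Γ.dist y z))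
        (t := {k ∈ range (Γ.diam + 1) ×ˢ range (Γ.diam + 1) |
          min k.1 (Γ.diam - k.1) = i ∧ min k.2 (Γ.diam - k.2) = j})]
      · refine sum_congr rfl fun k hk => ?_
        rw [filter_filter]
        congr 1
        ext z
        simp only [mem_filter, mem_univ, true_and] at hk ⊢
        constructor
        · rintro ⟨-, rfl⟩
          exact ⟨rfl, rfl⟩
        · rintro ⟨h1, h2⟩
          rw [h1, h2]
          exact ⟨hk.2, rfl⟩
      · intro z hz
        have h1 := hc.dist_le_diam x z
        have h2 := hc.dist_le_diam y z
        simp only [coe_filter, mem_univ, true_and, Set.mem_ofPred_eq, mem_product,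
          mem_range] at hz ⊢
        exact ⟨⟨by omega, by omega⟩, hz⟩
    intro i j x y x' y' hxy
    rw [hsum, hsum]
    exact sum_congr rfl fun k _ => h _ _ _ _ _ _ hxy
  have hrep : ∀ X Y : Quotient hanti.setoid, ∃ x y, Quotient.mk hanti.setoid x = X ∧
      Quotient.mk hanti.setoid y = Y ∧ Γ.dist x y = hanti.foldedGraph.dist X Y := by
    intro X Y
    induction X using Quotient.inductionOn with | _ x
    induction Y using Quotient.inductionOn with | _ y
    obtain ⟨v, hv, hdv⟩ := hanti.exists_near h hc x y
    exact ⟨x, v, rfl, (hanti.mk_eq_mk_iff.2 hv).symm,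
      by rw [hdv, hanti.foldedGraph_dist h hc hd]⟩
  have hcount : ∀ i j x y, #{z | min (Γ.dist x z) (Γ.diam - Γ.dist x z) = i ∧
        min (Γ.dist y z) (Γ.diam - Γ.dist y z) = j} =
      #{Z | hanti.foldedGraph.dist (Quotient.mk hanti.setoid x) Z = i ∧
        hanti.foldedGraph.dist (Quotient.mk hanti.setoid y) Z = j} * t := by
    intro i j x y
    rw [← hanti.card_filter_mk]
    congr 1
    ext z
    simp only [mem_filter, mem_univ, true_and, hanti.foldedGraph_dist h hc hd]
  intro i j X Y X' Y' hXY
  obtain ⟨x, y, rfl, rfl, hxy⟩ := hrep X Y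
  obtain ⟨x', y', rfl, rfl, hxy'⟩ := hrep X' Y'
  have := key i j x y x' y' (by omega)
  rw [hcount, hcount] at this
  exact Nat.eq_of_mul_eq_mul_right (by omega) this

/-! ### Lifting resolving sets from the folded graph. -/

theorem metricDimension_le {V : Type*} {Γ : SimpleGraph V} {S : Finset V} (hS : Γ.IsResolving S) :
    Γ.metricDimension ≤ #S :=
  Nat.sInf_le ⟨S, hS, rfl⟩

/-- A resolving set of the folded graph can be lifted, at the cost of one more class. -/
theorem IsAntipodal.metricDimension_le_of_isResolving (hanti : Γ.IsAntipodal t)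
    (h : Γ.HasIntersectionNumbers) (hc : Γ.Connected) (hd : 2 ≤ Γ.diam)
    {S : Finset (Quotient hanti.setoid)} (hS : hanti.foldedGraph.IsResolving S) :
    Γ.metricDimension ≤ (#S + 1) * (t - 1) := by
  have ht := hanti.two_le hc (by omega)
  have hhalf : ∀ X Y, 2 * hanti.foldedGraph.dist X Y ≤ Γ.diam := by
    intro X Y
    induction X using Quotient.inductionOn with | _ x
    induction Y using Quotient.inductionOn with | _ y
    rw [hanti.foldedGraph_dist h hc hd]
    omega
  -- A class at distance exactly $d/2$ from all of $S$ is unique, since $S$ resolves; adding it to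
  -- $S$ suffices.
  obtain ⟨T, hST, hT, hnear⟩ : ∃ T : Finset (Quotient hanti.setoid), S ⊆ T ∧ #T ≤ #S + 1 ∧
      ∀ X, ∃ C ∈ T, 2 * hanti.foldedGraph.dist X C < Γ.diam := by
    by_cases hX : ∃ X, ∀ C ∈ S, ¬ 2 * hanti.foldedGraph.dist X C < Γ.diam
    · obtain ⟨X₀, hX₀⟩ := hX
      refine ⟨insert X₀ S, subset_insert _ _, card_insert_le _ _, fun X => ?_⟩
      by_contra! hcon
      have : X = X₀ := hS _ _ fun C hC => by
        have h1 := hX₀ C hC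
        have h2 := hcon C (mem_insert_of_mem hC)
        have h3 := hhalf X C
        have h4 := hhalf X₀ C
        omega
      have h1 := hcon X₀ (mem_insert_self _ _)
      rw [this, dist_self] at h1
      omega
    · push Not at hX
      exact ⟨S, Subset.rfl, Nat.le_succ _, hX⟩
  -- One vertex, `Quotient.out`, is dropped from each class of $T$.
  set R : Finset V := {v | Quotient.mk hanti.setoid v ∈ T ∧
    (Quotient.mk hanti.setoid v).out ≠ v} with hR
  have hcard : #R = #T * (t - 1) := by
    have h1 : #{v | Quotient.mk hanti.setoid v ∈ T} = #R + #T := by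
      rw [← card_filter_add_card_filter_not (s := {v | Quotient.mk hanti.setoid v ∈ T})
        (fun v => (Quotient.mk hanti.setoid v).out ≠ v), filter_filter, filter_filter]
      congr 1
      refine (card_bij (fun C _ => C.out) ?_ ?_ ?_).symm
      · intro C hC
        simp [hC]
      · intro C _ D _ hCD
        rw [← Quotient.out_eq C, ← Quotient.out_eq D, hCD]
      · intro v hv
        simp only [mem_filter, mem_univ, true_and, not_not] at hv
        exact ⟨_, hv.1, hv.2⟩
    rw [hanti.card_filter_mk] at h1
    rw [Nat.mul_sub, h1]
    omega
  refine (metricDimension_le (S := R) ?_).trans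
    (hcard.le.trans (Nat.mul_le_mul_right _ hT))
  intro u w huw
  by_contra hne
  -- For $u,w$ in one class, the vertices of $C$ nearest to $u$ and to $w$ are distinct and each
  -- separates the two; at most one of them was dropped.
  by_cases hmk : Quotient.mk hanti.setoid u = Quotient.mk hanti.setoid w
  · have hr : Γ.AntipodalRel u w := hanti.mk_eq_mk_iff.1 hmk
    obtain ⟨C, hC, hCd⟩ := hnear (Quotient.mk hanti.setoid u)
    have hfind : ∀ x, Quotient.mk hanti.setoid u = Quotient.mk hanti.setoid x →
        ∃ v, Quotient.mk hanti.setoid v = C ∧ 2 * Γ.dist x v < Γ.diam := by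
      intro x hx
      rw [hx, ← Quotient.out_eq C, hanti.foldedGraph_dist h hc hd] at hCd
      obtain ⟨v, hv, hdv⟩ := hanti.exists_near h hc x C.out
      refine ⟨v, ?_, by omega⟩
      rw [← hanti.mk_eq_mk_iff.2 hv, Quotient.out_eq]
    have hfar : ∀ x y v, Γ.AntipodalRel x y → x ≠ y → 2 * Γ.dist x v < Γ.diam →
        2 * Γ.dist y v > Γ.diam := by
      intro x y v hxy hxy' hv
      have := hanti.dist_eq_diam_sub h hc hxy hxy' hv.le
      rw [dist_comm (u := y), this]
      omega
    obtain ⟨v, hvC, hv⟩ := hfind u rfl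
    obtain ⟨v', hvC', hv'⟩ := hfind w hmk
    have h1 := hfar u w v hr hne hv
    have h2 := hfar w u v' (hanti.equivalence.symm hr) (Ne.symm hne) hv'
    by_cases hout : C.out = v
    · have h3 : v' ∈ R := by
        simp only [hR, mem_filter, mem_univ, true_and, hvC']
        refine ⟨hC, fun he => ?_⟩
        have : v = v' := hout.symm.trans he
        subst this
        omega
      have := huw v' h3
      omega
    · have h3 : v ∈ R := by
        simp only [hR, mem_filter, mem_univ, true_and, hvC]
        exact ⟨hC, hout⟩
      have := huw v h3
      omega
  · refine hmk (hS _ _ fun C hC => ?_)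
    obtain ⟨v, hv, hvout⟩ : ∃ v ∈ ({v | Quotient.mk hanti.setoid v = C} : Finset V), v ≠ C.out :=
      exists_mem_ne (by rw [hanti.card_fiber C]; omega) _
    simp only [mem_filter, mem_univ, true_and] at hv
    subst hv
    have := huw v (by
      simp only [hR, mem_filter, mem_univ, true_and]
      exact ⟨hST hC, hvout.symm⟩)
    rw [hanti.foldedGraph_dist h hc hd, hanti.foldedGraph_dist h hc hd, this]

end Antipodal

/-! ### Lower bounds for distinguishers in primitive graphs. -/

section Primitive

variable {V : Type*} [Fintype V] {Γ : SimpleGraph V}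

theorem HasIntersectionNumbers.card_distinguishers_congr (h : Γ.HasIntersectionNumbers)
    (hc : Γ.Connected) {x y x' y' : V} (hxy : Γ.dist x y = Γ.dist x' y') :
    #(Γ.distinguishers x y) = #(Γ.distinguishers x' y') := by
  have key : ∀ x y, #(Γ.distinguishers x y) +
      ∑ i ∈ range (Γ.diam + 1), #{z | Γ.dist x z = i ∧ Γ.dist y z = i} = Fintype.card V := by
    intro x y
    rw [← card_univ, ← card_filter_add_card_filter_not (s := univ)
      (fun z => Γ.dist x z ≠ Γ.dist y z), distinguishers]
    congr 1
    rw [card_eq_sum_card_fiberwise (f := fun z => Γ.dist x z) (t := range (Γ.diam + 1))]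
    · refine sum_congr rfl fun i _ => ?_
      rw [filter_filter]
      congr 1
      ext z
      simp only [mem_filter, mem_univ, true_and]
      omega
    · intro z _
      have := hc.dist_le_diam x z
      simp only [coe_range, Set.mem_Iio]
      omega
  have h1 := key x y
  have h2 := key x' y'
  rw [sum_congr rfl fun i _ => h i i x y x' y' hxy] at h1
  omega

theorem HasIntersectionNumbers.card_sphere (h : Γ.HasIntersectionNumbers) (i : ℕ) (x x' : V) :
    #{z | Γ.dist x z = i} = #{z | Γ.dist x' z = i} := by
  have := h i i x x x' x' (by simp)
  simpa only [and_self] using this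

theorem card_distinguishers_triangle (x y z : V) :
    #(Γ.distinguishers x z) ≤ #(Γ.distinguishers x y) + #(Γ.distinguishers y z) := by
  refine (card_le_card fun v hv => ?_).trans (card_union_le _ _)
  simp only [mem_union, mem_distinguishers] at hv ⊢
  by_contra! hcon
  exact hv (hcon.1.trans hcon.2)

theorem HasIntersectionNumbers.card_distinguishers_le_length (h : Γ.HasIntersectionNumbers)
    (hc : Γ.Connected) {i : ℕ} {a b : V} (hab : Γ.dist a b = i) {x y : V}
    (p : (Γ.distanceGraph i).Walk x y) :
    #(Γ.distinguishers x y) ≤ p.length * #(Γ.distinguishers a b) := by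
  induction p with
  | nil => simp [distinguishers]
  | @cons u v w hadj p ih =>
    have h1 := card_distinguishers_triangle (Γ := Γ) u v w
    have h2 := h.card_distinguishers_congr hc (hadj.2.trans hab.symm)
    rw [Walk.length_cons, Nat.add_mul, one_mul]
    omega

theorem HasIntersectionNumbers.card_distinguishers_le_dist_mul (h : Γ.HasIntersectionNumbers)
    (hc : Γ.Connected) {i : ℕ} (hi : (Γ.distanceGraph i).Connected) {a b : V}
    (hab : Γ.dist a b = i) (x y : V) :
    #(Γ.distinguishers x y) ≤ (Γ.distanceGraph i).dist x y * #(Γ.distinguishers a b) := by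
  obtain ⟨p, hp⟩ := hi.exists_walk_length_eq_dist x y
  rw [← hp]
  exact h.card_distinguishers_le_length hc hab p

/-- Distance in the distance-$i$ graph is a function of distance in $\Gamma$: the penultimate vertex
of a geodesic is transferred by `exists_congr`. -/
theorem HasIntersectionNumbers.dist_distanceGraph_le (h : Γ.HasIntersectionNumbers)
    (hc : Γ.Connected) {i : ℕ} (hi0 : 0 < i) (hi : (Γ.distanceGraph i).Connected) (k : ℕ) :
    ∀ x y x' y', Γ.dist x y = Γ.dist x' y' → (Γ.distanceGraph i).dist x y = k →
      (Γ.distanceGraph i).dist x' y' ≤ k := by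
  induction k with
  | zero =>
    intro x y x' y' hxy hk
    rw [hi.dist_eq_zero_iff.1 hk, dist_self] at hxy
    rw [hc.dist_eq_zero_iff.1 hxy.symm, dist_self]
  | succ k ih =>
    intro x y x' y' hxy hk
    obtain ⟨z, hz1, hz2⟩ := hi.exists_dist_eq_of_le (i := k) (by omega :
      k ≤ (Γ.distanceGraph i).dist x y)
    have hyz : (Γ.distanceGraph i).Adj y z := dist_eq_one_iff_adj.1 (by omega)
    obtain ⟨z', hz1', hz2'⟩ := h.exists_congr hxy z
    have hyz' : (Γ.distanceGraph i).Adj z' y' := by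
      have e := hz2'.trans hyz.2
      refine Adj.symm ⟨?_, e⟩
      rintro rfl
      simp at e
      omega
    have h1 := ih x z x' z' hz1'.symm hz1
    have h2 := dist_eq_one_iff_adj.2 hyz'
    have h3 : (Γ.distanceGraph i).dist x' y' ≤ _ + _ := hi.dist_triangle (v := z')
    omega

theorem HasIntersectionNumbers.dist_distanceGraph_congr (h : Γ.HasIntersectionNumbers)
    (hc : Γ.Connected) {i : ℕ} (hi0 : 0 < i) (hi : (Γ.distanceGraph i).Connected)
    {x y x' y' : V} (hxy : Γ.dist x y = Γ.dist x' y') :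
    (Γ.distanceGraph i).dist x y = (Γ.distanceGraph i).dist x' y' :=
  le_antisymm (h.dist_distanceGraph_le hc hi0 hi _ _ _ _ _ hxy.symm rfl)
    (h.dist_distanceGraph_le hc hi0 hi _ _ _ _ _ hxy rfl)

/-- Vertices of a geodesic of the distance-$i$ graph starting at $x$ have distinct
$\Gamma$-distances from $x$, and only $d+1$ values are available. -/
theorem HasIntersectionNumbers.dist_distanceGraph_le_diam (h : Γ.HasIntersectionNumbers)
    (hc : Γ.Connected) {i : ℕ} (hi0 : 0 < i) (hi : (Γ.distanceGraph i).Connected) (x y : V) :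
    (Γ.distanceGraph i).dist x y ≤ Γ.diam := by
  set m := (Γ.distanceGraph i).dist x y with hm
  have hex : ∀ k, ∃ z, k ≤ m → (Γ.distanceGraph i).dist x z = k := by
    intro k
    by_cases hk : k ≤ m
    · obtain ⟨z, hz, -⟩ := hi.exists_dist_eq_of_le hk
      exact ⟨z, fun _ => hz⟩
    · exact ⟨x, fun h => absurd h hk⟩
  choose z hz using hex
  have := card_le_card_of_injOn (s := range (m + 1)) (t := range (Γ.diam + 1))
    (fun k => Γ.dist x (z k)) ?_ ?_
  · simpa using this
  · intro k _
    have := hc.dist_le_diam x (z k)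
    simp only [coe_range, Set.mem_Iio]
    omega
  · intro k hk l hl hkl
    simp only [coe_range, Set.mem_Iio] at hk hl
    rw [← hz k (by omega), ← hz l (by omega)]
    exact h.dist_distanceGraph_congr hc hi0 hi hkl

theorem ncard_sphere (x : V) (i : ℕ) :
    {w | Γ.dist x w = i}.ncard = #{w | Γ.dist x w = i} := by
  rw [← Set.ncard_coe_finset]
  congr 1
  ext
  simp

theorem bddAbove_ncard_sphere :
    BddAbove {m : ℕ | ∃ (v : V) (i : ℕ), {w | Γ.dist v w = i}.ncard = m} := by
  refine ⟨Fintype.card V, ?_⟩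
  rintro m ⟨v, i, rfl⟩
  rw [ncard_sphere]
  exact card_le_univ _

theorem card_sphere_le_maxDistanceClass (x : V) (i : ℕ) :
    #{w | Γ.dist x w = i} ≤ Γ.maxDistanceClass := by
  rw [← ncard_sphere]
  exact le_csSup bddAbove_ncard_sphere ⟨x, i, rfl⟩

theorem exists_card_sphere_eq_maxDistanceClass [Nonempty V] :
    ∃ (x : V) (i : ℕ), #{w | Γ.dist x w = i} = Γ.maxDistanceClass := by
  obtain ⟨x, i, h⟩ := Nat.sSup_mem (s := {m : ℕ | ∃ (v : V) (i : ℕ),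
    {w | Γ.dist v w = i}.ncard = m}) ⟨_, Classical.arbitrary V, 0, rfl⟩ bddAbove_ncard_sphere
  exact ⟨x, i, by rw [← ncard_sphere]; exact h⟩

theorem Connected.diam_lt_card (hc : Γ.Connected) : Γ.diam < Fintype.card V := by
  have := hc.nonempty
  obtain ⟨x, y, hxy⟩ := Γ.exists_dist_eq_diam
  obtain ⟨p, hp, hl⟩ := hc.exists_path_of_dist x y
  rw [← hxy, ← hl]
  exact hp.length_lt

theorem maxDistanceClass_lt_card (hc : Γ.Connected) (hd : 2 ≤ Γ.diam) :
    Γ.maxDistanceClass < Fintype.card V := by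
  have := hc.nonempty
  have hlt := hc.diam_lt_card
  obtain ⟨x, i, h⟩ := exists_card_sphere_eq_maxDistanceClass (Γ := Γ)
  rw [← h]
  refine lt_of_le_of_ne (card_le_univ _) fun he => ?_
  have hall : ∀ z, Γ.dist x z = i := by
    intro z
    have : z ∈ ({w | Γ.dist x w = i} : Finset V) := by
      rw [(card_eq_iff_eq_univ _).1 he]
      exact mem_univ z
    simpa using this
  have hi := hall x
  rw [dist_self] at hi
  have : Fintype.card V ≤ 1 := Fintype.card_le_one_iff.2 fun a b => by
    rw [← hc.dist_eq_zero_iff.1 ((hall a).trans hi.symm),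
      ← hc.dist_eq_zero_iff.1 ((hall b).trans hi.symm)]
  omega

/-- On average, two vertices have at least `|V| - M` distinguishers. -/
theorem exists_card_sub_le_card_distinguishers (hc : Γ.Connected) (hd : 2 ≤ Γ.diam) :
    ∃ x y : V, x ≠ y ∧ Fintype.card V ≤ #(Γ.distinguishers x y) + Γ.maxDistanceClass := by
  have := hc.nonempty
  have x : V := Classical.arbitrary V
  have hM := maxDistanceClass_lt_card hc hd
  obtain ⟨y, -, hy⟩ : ∃ y ∈ (univ : Finset V),
      Fintype.card V - Γ.maxDistanceClass ≤ #(Γ.distinguishers x y) := by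
    refine exists_le_of_sum_le univ_nonempty ?_
    have e : ∑ y, #(Γ.distinguishers x y) = ∑ z, #{y | Γ.dist x z ≠ Γ.dist y z} := by
      simp only [distinguishers, card_filter]
      exact sum_comm
    rw [e]
    refine sum_le_sum fun z _ => ?_
    have h1 := card_filter_add_card_filter_not (s := (univ : Finset V))
      (fun y => Γ.dist x z = Γ.dist y z)
    have h2 := card_sphere_le_maxDistanceClass (Γ := Γ) z (Γ.dist x z)
    have h3 : #{y | Γ.dist x z = Γ.dist y z} = #{w | Γ.dist z w = Γ.dist x z} := by
      congr 1
      ext y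
      simp only [mem_filter, mem_univ, true_and]
      rw [dist_comm (u := z), eq_comm]
    rw [card_univ] at h1
    simp only [ne_eq]
    omega
  refine ⟨x, y, ?_, by omega⟩
  rintro rfl
  simp [distinguishers] at hy
  omega

/-- Let $m$ be the radius of a largest sphere. Joining distinct vertices not at distance $m$ gives a
connected graph `H` of valency $\rho=|V|-M-1$. Some vertex at distance $m$ from $x$ is two `H`-steps
away, hence all are, so $M\le\rho^2$ and $|V|\le\rho^2+\rho+1\le(\rho+1)^2$. -/
theorem IsPrimitive.card_le_sq (hprim : Γ.IsPrimitive) (h : Γ.HasIntersectionNumbers)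
    (hc : Γ.Connected) (hd : 2 ≤ Γ.diam) :
    Fintype.card V ≤ (Fintype.card V - Γ.maxDistanceClass) ^ 2 := by
  have := hc.nonempty
  have hlt := hc.diam_lt_card
  have hMlt := maxDistanceClass_lt_card hc hd
  obtain ⟨x, m, hx⟩ := exists_card_sphere_eq_maxDistanceClass (Γ := Γ)
  -- If $m=0$ then $M=1$, and $|V|\ge 3$ suffices.
  by_cases hm0 : m = 0
  · have : Γ.maxDistanceClass = 1 := by
      rw [← hx, hm0, card_eq_one]
      exact ⟨x, by ext; simp [hc.dist_eq_zero_iff, eq_comm]⟩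
    rw [this]
    obtain ⟨k, hk⟩ : ∃ k, Fintype.card V = k + 3 := ⟨Fintype.card V - 3, by omega⟩
    rw [hk, show k + 3 - 1 = k + 2 by omega]
    nlinarith
  have hpos : 0 < Γ.maxDistanceClass := by
    refine lt_of_lt_of_le (card_pos.2 ⟨x, ?_⟩) (card_sphere_le_maxDistanceClass x 0)
    simp
  obtain ⟨y, hy⟩ := card_pos.1 (hx ▸ hpos)
  simp only [mem_filter, mem_univ, true_and] at hy
  let H : SimpleGraph V :=
    { Adj := fun u v => u ≠ v ∧ Γ.dist u v ≠ m
      symm := ⟨fun _ _ h => ⟨h.1.symm, by rw [dist_comm]; exact h.2⟩⟩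
      loopless := ⟨fun _ h => h.1 rfl⟩ }
  have hHadj : ∀ u v, H.Adj u v ↔ u ≠ v ∧ Γ.dist u v ≠ m := fun _ _ => Iff.rfl
  have hHc : H.Connected := by
    obtain ⟨i, hi0, hi, him⟩ : ∃ i, 0 < i ∧ i ≤ Γ.diam ∧ i ≠ m := by
      by_cases h1 : m = 1
      · exact ⟨2, by omega, hd, by omega⟩
      · exact ⟨1, by omega, by omega, Ne.symm h1⟩
    refine (hprim i hi0 hi).mono fun u v huv => ?_
    rw [hHadj]
    exact ⟨huv.1, huv.2.trans_ne him⟩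
  have hxy : x ≠ y := by
    rintro rfl
    exact hm0 (by rw [← hy, dist_self])
  have h2 : 2 ≤ H.dist x y := by
    have h3 : 0 < H.dist x y := hHc.pos_dist_of_ne hxy
    have h4 : H.dist x y ≠ 1 := fun h1 => (dist_eq_one_iff_adj.1 h1).2 hy
    omega
  obtain ⟨u, hu, -⟩ := hHc.exists_dist_eq_of_le h2
  obtain ⟨z, hz1, hz2⟩ := hHc.exists_dist_eq_of_le (i := 1) (by omega : 1 ≤ H.dist x u)
  have hxu : Γ.dist x u = m := by
    by_contra hne
    have : H.Adj x u := ⟨by rintro rfl; simp at hu, hne⟩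
    rw [← dist_eq_one_iff_adj] at this
    omega
  have hxz : H.Adj x z := dist_eq_one_iff_adj.1 hz1
  have huz : H.Adj u z := dist_eq_one_iff_adj.1 (by omega)
  set ρ := Fintype.card V - Γ.maxDistanceClass - 1 with hρ
  have hdeg : ∀ v, #{w | H.Adj v w} = ρ := by
    intro v
    have h1 := card_filter_add_card_filter_not (s := (univ : Finset V)) (fun w => Γ.dist v w = m)
    have h3 : ({w | ¬ Γ.dist v w = m} : Finset V) =
        insert v ({w | H.Adj v w} : Finset V) := by
      ext w
      simp only [mem_filter, mem_univ, true_and, mem_insert, hHadj]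
      by_cases hvw : w = v
      · subst hvw
        simp [Ne.symm hm0]
      · simp [hvw, Ne.symm hvw]
    rw [h3, card_insert_of_notMem (by simp), h.card_sphere m v x, hx, card_univ] at h1
    omega
  have hcover : #{w | Γ.dist x w = m} ≤ ρ * ρ := by
    calc #{w | Γ.dist x w = m}
        ≤ #(({w | H.Adj x w} : Finset V).biUnion fun v => {w | H.Adj v w}) := by
          refine card_le_card fun w hw => ?_
          simp only [mem_filter, mem_univ, true_and] at hw
          obtain ⟨v, hv1, hv2⟩ := h.exists_congr (hxu.trans hw.symm) z
          simp only [mem_biUnion, mem_filter, mem_univ, true_and]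
          refine ⟨v, ?_, Adj.symm ?_⟩
          · rw [hHadj]
            refine ⟨?_, hv1 ▸ hxz.2⟩
            rintro rfl
            rw [dist_self] at hv1
            exact hxz.1 (hc.dist_eq_zero_iff.1 hv1.symm)
          · rw [hHadj]
            refine ⟨?_, hv2 ▸ huz.2⟩
            rintro rfl
            rw [dist_self] at hv2
            exact huz.1 (hc.dist_eq_zero_iff.1 hv2.symm)
      _ ≤ #({w | H.Adj x w} : Finset V) * ρ :=
          card_biUnion_le_card_mul _ _ _ fun v _ => (hdeg v).le
      _ = ρ * ρ := by rw [hdeg]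
  rw [hx] at hcover
  have e1 : Fintype.card V = ρ + 1 + Γ.maxDistanceClass := by omega
  have e2 : Fintype.card V - Γ.maxDistanceClass = ρ + 1 := by omega
  rw [e2, e1]
  nlinarith

theorem IsPrimitive.card_sub_le_diam_mul (hprim : Γ.IsPrimitive) (h : Γ.HasIntersectionNumbers)
    (hc : Γ.Connected) (hd : 2 ≤ Γ.diam) {a b : V} (hab : a ≠ b) :
    Fintype.card V ≤ Γ.diam * #(Γ.distinguishers a b) + Γ.maxDistanceClass := by
  obtain ⟨x, y, -, hxy⟩ := exists_card_sub_le_card_distinguishers hc hd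
  have hi0 : 0 < Γ.dist a b := hc.pos_dist_of_ne hab
  have hi := hprim _ hi0 (hc.dist_le_diam a b)
  have h1 := h.card_distinguishers_le_dist_mul hc hi rfl x y
  have h2 := Nat.mul_le_mul_right #(Γ.distinguishers a b)
    (h.dist_distanceGraph_le_diam hc hi0 hi x y)
  omega

/-- Double counting of pairs $(y,z)$ with $y$ on the sphere about $a$ through $b$ and $z$
distinguishing $a,y$. Each $z\ne a$ occurs: the first step from $a$ towards $z$ in the distance
graph changes the distance to $z$ there, hence also in $\Gamma$. -/
theorem IsPrimitive.card_le_card_sphere_mul (hprim : Γ.IsPrimitive)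
    (h : Γ.HasIntersectionNumbers) (hc : Γ.Connected) {a b : V} (hab : a ≠ b) :
    Fintype.card V ≤ #{w | Γ.dist a w = Γ.dist a b} * #(Γ.distinguishers a b) := by
  have hi0 : 0 < Γ.dist a b := hc.pos_dist_of_ne hab
  have hi := hprim _ hi0 (hc.dist_le_diam a b)
  have e1 : #{w | Γ.dist a w = Γ.dist a b} * #(Γ.distinguishers a b) =
      ∑ y with Γ.dist a y = Γ.dist a b, #(Γ.distinguishers a y) := by
    rw [← smul_eq_mul, ← sum_const]
    refine sum_congr rfl fun y hy => ?_
    simp only [mem_filter, mem_univ, true_and] at hy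
    exact h.card_distinguishers_congr hc hy.symm
  have e2 : ∑ y with Γ.dist a y = Γ.dist a b, #(Γ.distinguishers a y) =
      ∑ z, #{y | Γ.dist a y = Γ.dist a b ∧ Γ.dist a z ≠ Γ.dist y z} := by
    simp only [distinguishers, card_filter, ← filter_filter]
    exact sum_comm
  rw [e1, e2, ← card_univ, card_eq_sum_ones]
  refine sum_le_sum fun z _ => card_pos.2 ?_
  simp only [Finset.Nonempty, mem_filter, mem_univ, true_and]
  rcases eq_or_ne a z with rfl | hne
  · exact ⟨b, rfl, by rw [dist_self, dist_comm]; omega⟩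
  · have hpos : 0 < (Γ.distanceGraph (Γ.dist a b)).dist a z := hi.pos_dist_of_ne hne
    obtain ⟨y, hy1, hy2⟩ := hi.exists_dist_eq_of_le (i := 1) hpos
    refine ⟨y, (dist_eq_one_iff_adj.1 hy1).2, fun he => ?_⟩
    have := h.dist_distanceGraph_congr hc hi0 hi he
    rw [dist_comm (u := z)] at hy2
    omega

/-- Two vertices of a primitive distance-regular graph have at least `√|V| / 2` distinguishers. -/
theorem IsPrimitive.card_le_four_mul_sq (hprim : Γ.IsPrimitive) (h : Γ.HasIntersectionNumbers)
    (hc : Γ.Connected) (hd : 2 ≤ Γ.diam) {a b : V} (hab : a ≠ b) :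
    Fintype.card V ≤ 4 * #(Γ.distinguishers a b) ^ 2 := by
  have hi0 : 0 < Γ.dist a b := hc.pos_dist_of_ne hab
  have hi := hprim _ hi0 (hc.dist_le_diam a b)
  -- If the distance graph has diameter at most $2$, a well distinguished pair gives $|V|-M\le 2D$,
  -- where $D$ is the number of distinguishers of $a,b$.
  by_cases htwo : ∀ x y, (Γ.distanceGraph (Γ.dist a b)).dist x y ≤ 2
  · obtain ⟨x, y, -, hxy⟩ := exists_card_sub_le_card_distinguishers hc hd
    have h1 := h.card_distinguishers_le_dist_mul hc hi rfl x y
    have h2 := Nat.mul_le_mul_right #(Γ.distinguishers a b) (htwo x y)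
    refine (hprim.card_le_sq h hc hd).trans ?_
    calc (Fintype.card V - Γ.maxDistanceClass) ^ 2 ≤ (2 * #(Γ.distinguishers a b)) ^ 2 :=
          Nat.pow_le_pow_left (by omega) 2
      _ = 4 * #(Γ.distinguishers a b) ^ 2 := by ring
  · push Not at htwo
    obtain ⟨x, y', hxy'⟩ := htwo
    -- For $x,y$ at distance $3$ in the distance graph, the spheres of size $k$ about them are
    -- disjoint and consist of distinguishers. So $2k\le 3D$, and $|V|\le kD\le\frac32D^2$.
    obtain ⟨y, hy, -⟩ := hi.exists_dist_eq_of_le (i := 3) hxy'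
    have h1 := hprim.card_le_card_sphere_mul h hc hab
    have h2 := h.card_distinguishers_le_dist_mul hc hi rfl x y
    rw [hy] at h2
    have hadj : ∀ u v, Γ.dist u v = Γ.dist a b → (Γ.distanceGraph (Γ.dist a b)).Adj u v := by
      intro u v huv
      refine ⟨?_, huv⟩
      rintro rfl
      rw [dist_self] at huv
      omega
    have hdisj : ∀ z, Γ.dist x z = Γ.dist a b → Γ.dist y z ≠ Γ.dist a b := by
      intro z hxz hyz
      have h3 := dist_eq_one_iff_adj.2 (hadj _ _ hxz)
      have h4 := dist_eq_one_iff_adj.2 (hadj _ _ hyz)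
      have h5 : (Γ.distanceGraph (Γ.dist a b)).dist x y ≤ _ + _ := hi.dist_triangle (v := z)
      rw [dist_comm (u := z)] at h5
      omega
    have h3 : #{w | Γ.dist x w = Γ.dist a b} + #{w | Γ.dist y w = Γ.dist a b} ≤
        #(Γ.distinguishers x y) := by
      rw [← card_union_of_disjoint]
      · refine card_le_card fun z hz => ?_
        simp only [mem_union, mem_filter, mem_univ, true_and, mem_distinguishers] at hz ⊢
        have := hdisj z
        omega
      · rw [Finset.disjoint_left]
        intro z hz
        simp only [mem_filter, mem_univ, true_and] at hz ⊢
        exact hdisj z hz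
    rw [h.card_sphere _ x a, h.card_sphere _ y a] at h3
    nlinarith

/-- Babai's bounds for the metric dimension of a primitive distance-regular graph. -/
theorem IsPrimitive.exists_isResolving_sqrt (hprim : Γ.IsPrimitive)
    (h : Γ.HasIntersectionNumbers) (hc : Γ.Connected) (hd : 2 ≤ Γ.diam) :
    ∃ S : Finset V, Γ.IsResolving S ∧
      (#S : ℝ) < 4 * Real.sqrt (Fintype.card V) * Real.log (Fintype.card V) := by
  have hlt := hc.diam_lt_card
  have hn : (1 : ℝ) ≤ Fintype.card V := by exact_mod_cast (by omega : 1 ≤ Fintype.card V)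
  have hs : 1 ≤ Real.sqrt (Fintype.card V) := Real.one_le_sqrt.2 hn
  have hsq : Real.sqrt (Fintype.card V) * Real.sqrt (Fintype.card V) = Fintype.card V :=
    Real.mul_self_sqrt (by linarith)
  obtain ⟨S, hS, hcard⟩ := Γ.exists_isResolving_card_lt (D := Real.sqrt (Fintype.card V) / 2)
    (by omega) (by linarith) (by nlinarith) fun a b hab => by
      have h1 : (Fintype.card V : ℝ) ≤ 4 * (#(Γ.distinguishers a b) : ℝ) ^ 2 := by
        exact_mod_cast hprim.card_le_four_mul_sq h hc hd hab
      have h2 : Real.sqrt (Fintype.card V) ≤ 2 * #(Γ.distinguishers a b) :=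
        Real.sqrt_le_iff.2 ⟨by positivity, by linarith⟩
      linarith
  refine ⟨S, hS, hcard.trans_eq ?_⟩
  rw [div_eq_iff (by linarith)]
  linear_combination (-2 * Real.log (Fintype.card V)) * hsq

theorem IsPrimitive.exists_isResolving_maxDistanceClass (hprim : Γ.IsPrimitive)
    (h : Γ.HasIntersectionNumbers) (hc : Γ.Connected) (hd : 2 ≤ Γ.diam) :
    ∃ S : Finset V, Γ.IsResolving S ∧
      (#S : ℝ) < 2 * Γ.diam * (Fintype.card V / (Fintype.card V - Γ.maxDistanceClass)) *
        Real.log (Fintype.card V) := by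
  have hlt := hc.diam_lt_card
  have hM : (0 : ℝ) < Fintype.card V - Γ.maxDistanceClass :=
    sub_pos.2 (by exact_mod_cast maxDistanceClass_lt_card hc hd)
  have hd' : (2 : ℝ) ≤ Γ.diam := by exact_mod_cast hd
  have hM0 : (0 : ℝ) ≤ Γ.maxDistanceClass := Nat.cast_nonneg _
  obtain ⟨S, hS, hcard⟩ := Γ.exists_isResolving_card_lt
    (D := (Fintype.card V - Γ.maxDistanceClass) / Γ.diam)
    (by omega) (by positivity) (by
      refine (div_le_div_of_nonneg_left hM.le two_pos hd').trans ?_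
      linarith) fun a b hab => by
      have h1 : (Fintype.card V : ℝ) ≤
          Γ.diam * #(Γ.distinguishers a b) + Γ.maxDistanceClass := by
        exact_mod_cast hprim.card_sub_le_diam_mul h hc hd hab
      rw [div_le_iff₀ (by linarith)]
      linarith
  refine ⟨S, hS, hcard.trans_eq ?_⟩
  field_simp

end Primitive

/-! ### Combination of the two bounds with the lifting. -/

/-- The metric dimension of an antipodal distance-regular graph is bounded by means of a resolving
set of the folded graph. -/
theorem IsAntipodal.metricDimension_lt {V : Type*} [Fintype V] {Γ : SimpleGraph V} {t : ℕ}
    (hanti : Γ.IsAntipodal t) (h : Γ.HasIntersectionNumbers) (hc : Γ.Connected)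
    (hd : 2 ≤ Γ.diam) {S : Finset (Quotient hanti.setoid)}
    (hS : hanti.foldedGraph.IsResolving S) {B : ℝ} (hB : (#S : ℝ) < B) :
    (Γ.metricDimension : ℝ) < ((t : ℝ) - 1) * (B + 1) := by
  have ht := hanti.two_le hc (by omega)
  have h1 := hanti.metricDimension_le_of_isResolving h hc hd hS
  have h2 : (Γ.metricDimension : ℝ) ≤ (#S + 1) * ((t : ℝ) - 1) := by
    have : (Γ.metricDimension : ℝ) ≤ (((#S + 1) * (t - 1) : ℕ) : ℝ) := by exact_mod_cast h1
    rwa [Nat.cast_mul, Nat.cast_sub (by omega), Nat.cast_add, Nat.cast_one] at this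
  have ht' : (1 : ℝ) < t := by exact_mod_cast ht
  rw [mul_comm]
  exact h2.trans_lt (mul_lt_mul_of_pos_right (by linarith) (by linarith))

end SimpleGraph

theorem mainTheorem11 {V : Type*} [Fintype V] (Γ : SimpleGraph V) (t : ℕ)
    (hreg : Γ.IsDistanceRegular) (hdiam : 4 ≤ Γ.diam) (hanti : Γ.IsAntipodal t)
    (hprim : hanti.foldedGraph.IsPrimitive) (hfdiam : 2 ≤ hanti.foldedGraph.diam) :
    (Γ.metricDimension : ℝ) <
        ((t : ℝ) - 1) *
          (4 * Real.sqrt ((Fintype.card V : ℝ) / (t : ℝ)) *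
            Real.log ((Fintype.card V : ℝ) / (t : ℝ)) + 1) ∧
      (Γ.metricDimension : ℝ) <
        ((t : ℝ) - 1) *
          (2 * (hanti.foldedGraph.diam : ℝ) *
            ((Fintype.card V : ℝ) /
              ((Fintype.card V : ℝ) - (t : ℝ) * (hanti.foldedGraph.maxDistanceClass : ℝ))) *
            Real.log ((Fintype.card V : ℝ) / (t : ℝ)) + 1) := by
  have h := hreg.hasIntersectionNumbers
  have hc := hreg.1
  have hd : 2 ≤ Γ.diam := by omega
  have ht := hanti.two_le hc (by omega)
  let _ : Fintype (Quotient hanti.setoid) := Fintype.ofFinite _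
  have ht' : (t : ℝ) ≠ 0 := by exact_mod_cast (by omega : t ≠ 0)
  have hcard : (Fintype.card V : ℝ) = Fintype.card (Quotient hanti.setoid) * t := by
    exact_mod_cast hanti.card_eq
  have hf := hanti.foldedGraph_hasIntersectionNumbers h hc hd
  have hfc := hanti.foldedGraph_connected hc hd
  have hdiv : (Fintype.card V : ℝ) / t = Fintype.card (Quotient hanti.setoid) := by
    rw [hcard, mul_div_cancel_right₀ _ ht']
  have hratio : (Fintype.card V : ℝ) /
      ((Fintype.card V : ℝ) - (t : ℝ) * (hanti.foldedGraph.maxDistanceClass : ℝ)) =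
      Fintype.card (Quotient hanti.setoid) /
        (Fintype.card (Quotient hanti.setoid) - hanti.foldedGraph.maxDistanceClass) := by
    rw [hcard, mul_comm (t : ℝ), ← sub_mul, mul_div_mul_right _ _ ht']
  obtain ⟨S₁, hS₁, hB₁⟩ := hprim.exists_isResolving_sqrt hf hfc hfdiam
  obtain ⟨S₂, hS₂, hB₂⟩ := hprim.exists_isResolving_maxDistanceClass hf hfc hfdiam
  rw [hratio, hdiv]
  exact ⟨hanti.metricDimension_lt h hc hd hS₁ hB₁, hanti.metricDimension_lt h hc hd hS₂ hB₂⟩
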